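/- For an irrational $x\in[0,1)$ write $x=[a_1,a_2,\dots]=\cfrac{1}{a_1+\cfrac{1}{a_2+\cdots}}$ for its regular continued fraction expansion; a rational number in $(0,1)$ is written in its reduced form $[a_1,\dots,a_n]$, $a_n\ge 2$. The Minkowski question mark measure $\mu_?$ is the probability measure on $[0,1)$ with distribution function $$?(x)=2\sum_{i\ge1}\frac{(-1)^{i+1}}{2^{a_1(x)+\cdots+a_i(x)}},$$ where the sum runs over the digits of $x$ (finitely many if $x$ is rational). For a block $d=d_1,\dots,d_k$ of positive integers, $k\ge1$, let $\Delta(d)$ be the set of $y\in[0,1)$ whose expansion starts with $d_1,\dots,d_k$, and let $G_n(x,d)$ be the number of occurrences of $d$ within the first $n$ continued fraction digits of $x$. A number $x\in[0,1)$ is called Minkowski normal if for every $k\ge1$ and every such block $d$ $$\lim_{n\to\infty}\frac1n\,G_n(x,d)=\mu_?(\Delta(d))=2^{-(d_1+\cdots+d_k)}.$$ The Farey tree is the infinite binary tree of rationals with root $1/2=[2]$ in which the node $[a_1,\dots,a_n]$ (reduced form) has the two children $[a_1,\dots,a_{n-1},a_n+1]$ and $[a_1,\dots,a_{n-1},a_n-1,2]$;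 the first is the left child and the second the right child if $n$ is odd, and the other way round if $n$ is even. Read top-down, left-right it lists the rationals $\frac12,\ \frac13,\frac23,\ \frac14,\frac25,\frac35,\frac34,\ \frac15,\dots$ **Theorem.** Concatenate the reduced continued fraction expansions of the rationals in the Farey tree, read top-down and left-right. The resulting infinite sequence of digits is the continued fraction expansion of an irrational number in $[0,1)$, namely the limit of its convergents, and this number is Minkowski normal. -/

import Mathlib

open Filter Topology MeasureTheory

noncomputable section

namespace MinkowskiNormality

/-! ### Continued fraction digits of a real number -/

/-- The digit `a_{n+1}(x)` (indexing from `0`) of the regular continued fraction expansion of `x`.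
The value `0`, which is never a digit, says that the expansion has at most `n` digits.
For rational `x` in `(0,1)` this is the reduced expansion, with last digit at least `2`. -/
def cfDigit (x : ℝ) (n : ℕ) : ℕ :=
  ⌊((GenContFract.of x).partDens.get? n).getD 0⌋₊

/-- The value `[a₁, …, aₙ] = 1 / (a₁ + 1 / (a₂ + ⋯))` of a finite list of digits. -/
def cfEval : List ℕ → ℝ
  | [] => 0
  | a :: t => 1 / ((a : ℝ) + cfEval t)

/-- The cylinder `Δ(d)`: all `y ∈ [0,1)` whose expansion starts with the block `d`. -/
def cylinder (d : List ℕ) : Set ℝ :=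
  {y | y ∈ Set.Ico (0 : ℝ) 1 ∧ ∀ j < d.length, cfDigit y j = d.getD j 0}

/-- `G_n(x, d)`: the number of occurrences of the block `d` within the first `n` continued
fraction digits of `x`. -/
def blockCount (n : ℕ) (x : ℝ) (d : List ℕ) : ℕ :=
  ((Finset.range n).filter fun i =>
    i + d.length ≤ n ∧ ∀ j < d.length, cfDigit x (i + j) = d.getD j 0).card

/-! ### The Minkowski question mark measure -/

/-- The summand `(-1)^(i+1) / 2^(a₁ + ⋯ + aᵢ)` (here with `i + 1` in place of `i`), present only
as long as the digit exists. -/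
def questionTerm (x : ℝ) (i : ℕ) : ℝ :=
  if cfDigit x i = 0 then 0
  else (-1) ^ (i + 2) / 2 ^ (∑ j ∈ Finset.range (i + 1), cfDigit x j)

/-- The Minkowski question mark function `?` on `[0,1)`. -/
def questionMark (x : ℝ) : ℝ := 2 * ∑' i, questionTerm x i

/-- The distribution function of the Minkowski question mark measure on the whole line. -/
def questionCDF (x : ℝ) : ℝ :=
  if x < 0 then 0 else if x < 1 then questionMark x else 1

lemma cfDigit_zero_eq (x : ℝ) : cfDigit x 0 = ⌊(Int.fract x)⁻¹⌋₊ := by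
  unfold cfDigit
  by_cases h : Int.fract x = 0
  · obtain ⟨a, rfl⟩ : ∃ a : ℤ, x = a := ⟨⌊x⌋, eq_of_sub_eq_zero h⟩
    have : (GenContFract.of (a : ℝ)).partDens.get? 0 = none := by
      rw [GenContFract.partDen_none_iff_s_none, GenContFract.of_s_of_int]; rfl
    rw [this]; simp
  · have h1 : (GenContFract.of x).s.get? 0 = some ⟨1, ⌊(Int.fract x)⁻¹⌋⟩ :=
      GenContFract.of_s_head h
    rw [GenContFract.partDen_eq_s_b h1]
    have : (0 : ℤ) ≤ ⌊(Int.fract x)⁻¹⌋ := Int.floor_nonneg.2 (inv_nonneg.2 (Int.fract_nonneg x))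
    simp only [Option.getD_some]
    rw [← natCast_floor_eq_intCast_floor (inv_nonneg.2 (Int.fract_nonneg x)), Nat.floor_natCast]

lemma cfDigit_succ (x : ℝ) (n : ℕ) : cfDigit x (n + 1) = cfDigit (Int.fract x)⁻¹ n := by
  unfold cfDigit GenContFract.partDens
  rw [Stream'.Seq.map_get?, Stream'.Seq.map_get?, GenContFract.of_s_succ]

lemma cfDigit_zero_left (n : ℕ) : cfDigit 0 n = 0 := by
  induction n with
  | zero => simp [cfDigit_zero_eq]
  | succ n ih => rw [cfDigit_succ]; simpa using ih

lemma fract_eq_zero_of_digit {x : ℝ} (h : cfDigit x 0 = 0) : Int.fract x = 0 := by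
  rw [cfDigit_zero_eq, Nat.floor_eq_zero] at h
  by_contra h0
  have h1 : 0 < Int.fract x := lt_of_le_of_ne (Int.fract_nonneg x) (Ne.symm h0)
  exact absurd ((one_lt_inv₀ h1).2 (Int.fract_lt_one x)) (not_lt.2 h.le)

lemma questionTerm_zero_left (i : ℕ) : questionTerm 0 i = 0 := by
  simp [questionTerm, cfDigit_zero_left]

lemma questionTerm_succ (x : ℝ) (i : ℕ) :
    questionTerm x (i + 1) = -(1 / 2 ^ cfDigit x 0) * questionTerm (Int.fract x)⁻¹ i := by
  unfold questionTerm
  rw [Finset.sum_range_succ' _ (i + 1)]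
  simp only [cfDigit_succ]
  split_ifs
  · simp
  · rw [pow_add 2, pow_succ (-1 : ℝ) (i + 2)]
    field_simp

lemma abs_questionTerm_le (x : ℝ) (i : ℕ) : |questionTerm x i| ≤ (1 / 2) ^ (i + 1) := by
  have key : ∀ x : ℝ, cfDigit x 0 ≠ 0 → (1 : ℝ) / 2 ^ cfDigit x 0 ≤ 1 / 2 := by
    intro x hx
    apply one_div_le_one_div_of_le (by norm_num)
    calc (2 : ℝ) = 2 ^ 1 := by norm_num
      _ ≤ 2 ^ cfDigit x 0 := pow_le_pow_right₀ (by norm_num) (Nat.one_le_iff_ne_zero.2 hx)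
  induction i generalizing x with
  | zero =>
    unfold questionTerm
    split_ifs with h
    · simp
    · simpa using key x h
  | succ i ih =>
    rw [questionTerm_succ]
    by_cases h : cfDigit x 0 = 0
    · rw [fract_eq_zero_of_digit h, inv_zero, questionTerm_zero_left]
      simp
    · rw [abs_mul, abs_neg, abs_of_pos (by positivity : (0 : ℝ) < 1 / 2 ^ cfDigit x 0), pow_succ' _ (i + 1)]
      exact mul_le_mul (key x h) (ih _) (abs_nonneg _) (by norm_num)

lemma summable_questionTerm (x : ℝ) : Summable (questionTerm x) := by
  have h : Summable fun i : ℕ => ((1 : ℝ) / 2) ^ (i + 1) :=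
    (summable_nat_add_iff 1).2 (summable_geometric_of_lt_one (by norm_num) (by norm_num))
  exact Summable.of_norm_bounded h (fun i => abs_questionTerm_le x i)

lemma questionSum_succ (x : ℝ) (h : cfDigit x 0 ≠ 0) (n : ℕ) :
    2 * ∑ i ∈ Finset.range (n + 1), questionTerm x i =
      1 / 2 ^ cfDigit x 0 *
        (2 - 2 * ∑ i ∈ Finset.range n, questionTerm (Int.fract x)⁻¹ i) := by
  rw [Finset.sum_range_succ']
  simp only [questionTerm_succ, ← Finset.mul_sum]
  have : questionTerm x 0 = 1 / 2 ^ cfDigit x 0 := by simp [questionTerm, h]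
  rw [this]; ring

lemma questionSum_of_digit_zero (x : ℝ) (h : cfDigit x 0 = 0) (n : ℕ) :
    2 * ∑ i ∈ Finset.range n, questionTerm x i = 0 := by
  have : ∀ i, questionTerm x i = 0 := by
    intro i
    cases i with
    | zero => simp [questionTerm, h]
    | succ i => rw [questionTerm_succ, fract_eq_zero_of_digit h, inv_zero, questionTerm_zero_left,
        mul_zero]
  simp [this]

lemma questionSum_mem (n : ℕ) (x : ℝ) :
    0 ≤ 2 * ∑ i ∈ Finset.range n, questionTerm x i ∧
      2 * ∑ i ∈ Finset.range n, questionTerm x i ≤ 1 := by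
  induction n generalizing x with
  | zero => simp
  | succ n ih =>
    by_cases h : cfDigit x 0 = 0
    · rw [questionSum_of_digit_zero x h]; norm_num
    · rw [questionSum_succ x h]
      obtain ⟨h0, h1⟩ := ih (Int.fract x)⁻¹
      have h2 : (2 : ℝ) ≤ 2 ^ cfDigit x 0 := by
        calc (2 : ℝ) = 2 ^ 1 := by norm_num
          _ ≤ 2 ^ cfDigit x 0 := pow_le_pow_right₀ (by norm_num) (Nat.one_le_iff_ne_zero.2 h)
      have h3 : (0 : ℝ) < 1 / 2 ^ cfDigit x 0 := by positivity
      have h4 : (1 : ℝ) / 2 ^ cfDigit x 0 ≤ 1 / 2 := one_div_le_one_div_of_le (by norm_num) h2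
      constructor
      · exact mul_nonneg h3.le (by linarith)
      · nlinarith

lemma questionSum_mono (n : ℕ) (x y : ℝ) (hxy : Int.fract x ≤ Int.fract y) :
    2 * ∑ i ∈ Finset.range n, questionTerm x i ≤ 2 * ∑ i ∈ Finset.range n, questionTerm y i := by
  induction n generalizing x y with
  | zero => simp
  | succ n ih =>
    by_cases hx : cfDigit x 0 = 0
    · rw [questionSum_of_digit_zero x hx]; exact (questionSum_mem _ y).1
    · have hfx : 0 < Int.fract x := by
        rcases (Int.fract_nonneg x).eq_or_lt with h | h
        · rw [cfDigit_zero_eq, ← h] at hx; simp at hx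
        · exact h
      have hinv : (Int.fract y)⁻¹ ≤ (Int.fract x)⁻¹ := inv_anti₀ hfx hxy
      have hfy : 0 < Int.fract y := hfx.trans_le hxy
      have hle : cfDigit y 0 ≤ cfDigit x 0 := by
        rw [cfDigit_zero_eq, cfDigit_zero_eq]; exact Nat.floor_le_floor hinv
      have hy : cfDigit y 0 ≠ 0 := fun h => hfy.ne' (fract_eq_zero_of_digit h)
      rw [questionSum_succ x hx, questionSum_succ y hy]
      obtain ⟨a0, a1⟩ := questionSum_mem n (Int.fract x)⁻¹
      obtain ⟨b0, b1⟩ := questionSum_mem n (Int.fract y)⁻¹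
      rcases hle.eq_or_lt with heq | hlt
      · rw [heq]
        have hf : Int.fract (Int.fract y)⁻¹ ≤ Int.fract (Int.fract x)⁻¹ := by
          have : (⌊(Int.fract y)⁻¹⌋ : ℤ) = ⌊(Int.fract x)⁻¹⌋ := by
            rw [cfDigit_zero_eq, cfDigit_zero_eq] at heq
            rw [← Int.natCast_floor_eq_floor (inv_nonneg.2 hfy.le),
              ← Int.natCast_floor_eq_floor (inv_nonneg.2 hfx.le), heq]
          unfold Int.fract at *
          rw [this]; linarith
        have := ih _ _ hf
        have h3 : (0 : ℝ) < 1 / 2 ^ cfDigit x 0 := by positivity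
        exact mul_le_mul_of_nonneg_left (by linarith) h3.le
      · have h3 : (0 : ℝ) < 1 / 2 ^ cfDigit x 0 := by positivity
        have h4 : (0 : ℝ) < 1 / 2 ^ cfDigit y 0 := by positivity
        have h5 : (2 : ℝ) * (1 / 2 ^ cfDigit x 0) ≤ 1 / 2 ^ cfDigit y 0 := by
          have : (2 : ℝ) ^ (cfDigit y 0 + 1) ≤ 2 ^ cfDigit x 0 :=
            pow_le_pow_right₀ (by norm_num) hlt
          rw [pow_succ] at this
          rw [mul_one_div, div_le_div_iff₀ (by positivity) (by positivity)]
          linarith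
        nlinarith

lemma tendsto_questionSum (x : ℝ) :
    Tendsto (fun n => 2 * ∑ i ∈ Finset.range n, questionTerm x i) atTop (𝓝 (questionMark x)) :=
  (summable_questionTerm x).hasSum.tendsto_sum_nat.const_mul 2

lemma questionCDF_mono : Monotone questionCDF := by
  have h0 : ∀ x, 0 ≤ questionMark x := fun x =>
    ge_of_tendsto' (tendsto_questionSum x) fun n => (questionSum_mem n x).1
  have h1 : ∀ x, questionMark x ≤ 1 := fun x =>
    le_of_tendsto' (tendsto_questionSum x) fun n => (questionSum_mem n x).2
  intro x y hxy
  unfold questionCDF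
  split_ifs with a b c d e f
  · exact le_rfl
  · exact h0 y
  · exact zero_le_one
  · linarith
  · refine le_of_tendsto_of_tendsto' (tendsto_questionSum x) (tendsto_questionSum y) fun n => ?_
    apply questionSum_mono
    rw [Int.fract_eq_self.2 ⟨not_lt.1 a, d⟩, Int.fract_eq_self.2 ⟨not_lt.1 e, f⟩]
    exact hxy
  · exact h1 x
  · linarith
  · linarith
  · exact le_rfl

/-- The Minkowski question mark measure `μ_?`: the Lebesgue–Stieltjes measure of its
distribution function. -/
def questionMeasure : Measure ℝ := questionCDF_mono.stieltjesFunction.measure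

/-- `x` is Minkowski normal if each nonempty block `d` of positive integers occurs among the
continued fraction digits of `x` with asymptotic frequency `μ_?(Δ(d)) = 2^{-(d₁ + ⋯ + d_k)}`. -/
def MinkowskiNormal (x : ℝ) : Prop :=
  x ∈ Set.Ico (0 : ℝ) 1 ∧
    ∀ d : List ℕ, d ≠ [] → (∀ a ∈ d, 0 < a) →
      Tendsto (fun n : ℕ => (blockCount n x d : ℝ) / n) atTop
        (𝓝 (questionMeasure (cylinder d)).toReal) ∧
      questionMeasure (cylinder d) = ENNReal.ofReal ((1 / 2) ^ d.sum)

/-! ### The Farey tree -/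

/-- `[a₁, …, aₙ] ↦ [a₁, …, aₙ + 1]`. -/
def incrLast (c : List ℕ) : List ℕ := c.dropLast ++ [c.getLastD 0 + 1]

/-- `[a₁, …, aₙ] ↦ [a₁, …, aₙ - 1, 2]`. -/
def splitLast (c : List ℕ) : List ℕ := c.dropLast ++ [c.getLastD 0 - 1, 2]

/-- The two children, left to right, of a rational in the Farey tree, each rational being
given by the digits of its reduced continued fraction expansion. -/
def fareyChildren (c : List ℕ) : List (List ℕ) :=
  if Odd c.length then [incrLast c, splitLast c] else [splitLast c, incrLast c]

/-- Level `l` of the Farey tree, left to right; the root is `1/2 = [2]`. -/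
def fareyLevel : ℕ → List (List ℕ)
  | 0 => [[2]]
  | l + 1 => (fareyLevel l).flatMap fareyChildren

/-- The concatenation of all expansions in the levels `0, …, L - 1`, top-down, left-right. -/
def fareyPrefix : ℕ → List ℕ
  | 0 => []
  | L + 1 => fareyPrefix L ++ (fareyLevel L).flatten

/-- The infinite concatenation of the expansions in the Farey tree. The first `n + 1` levels
contain more than `n` digits, see `lt_length_fareyPrefix`. -/
def fareyDigit (n : ℕ) : ℕ := (fareyPrefix (n + 1)).getD n 0

lemma fareyLevel_flatten_ne_nil (l : ℕ) :
    fareyLevel l ≠ [] ∧ ∀ c ∈ fareyLevel l, c ≠ [] := by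
  induction l with
  | zero => simp [fareyLevel]
  | succ l ih =>
    obtain ⟨h1, h2⟩ := ih
    constructor
    · obtain ⟨c, t, h⟩ := List.exists_cons_of_ne_nil h1
      rw [fareyLevel, h, List.flatMap_cons]
      unfold fareyChildren
      split_ifs <;> simp
    · intro c hc
      rw [fareyLevel, List.mem_flatMap] at hc
      obtain ⟨b, -, hb⟩ := hc
      unfold fareyChildren incrLast splitLast at hb
      split_ifs at hb <;> simp at hb <;> rcases hb with rfl | rfl <;> simp

lemma lt_length_fareyPrefix (n : ℕ) : n < (fareyPrefix (n + 1)).length := by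
  have key : ∀ L, L ≤ (fareyPrefix L).length := by
    intro L
    induction L with
    | zero => simp
    | succ L ih =>
      obtain ⟨h1, h2⟩ := fareyLevel_flatten_ne_nil L
      obtain ⟨c, t, h⟩ := List.exists_cons_of_ne_nil h1
      have hc : c ≠ [] := h2 c (by simp [h])
      have := List.length_pos_iff.2 hc
      rw [fareyPrefix, List.length_append, h, List.flatten_cons, List.length_append]
      omega
  exact key (n + 1)

/-- The finite continued fraction given by the first `n` digits of the concatenation. -/
def fareyConvergent (n : ℕ) : ℝ := cfEval ((List.range n).map fareyDigit)

/-- The value of the infinite continued fraction whose digits are the concatenation of the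
expansions in the Farey tree, as the limit of its convergents. -/
def fareyNumber : ℝ := limUnder atTop fareyConvergent

end MinkowskiNormality

end

/-!
A node with last digit `r + 1` carries an unfinished digit of `r` units. Descending in the Farey
tree by fair coin tosses, each toss either adds a unit to this digit or closes it with `r` units and
opens a new one, so a digit `a` appears with probability `2 ^ (-a)` whatever the preceding digits
are. Hence the number of occurrences of `d, a` minus `2 ^ (-a)` times the number of occurrences of
`d`, corrected by the conditional expectation of the contribution of the unfinished digit, is a
martingale with bounded increments. Its second moment on level `l` is at most `l + 1`, so by
Cauchy–Schwarz the deviations of the `2 ^ l` nodes of level `l` add up to `O(2 ^ l √l)`. The first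
`L` levels thus deviate by `O(2 ^ L √L)`, including the blocks that straddle two nodes, while they
have `2 ^ (L - 1) L` digits. So `d, a` asymptotically takes the share `2 ^ (-a)` of the occurrences
of `d`, and induction on the block gives all the frequencies.

On the side of the measure, `?((a + z)⁻¹) = (2 - ?(z)) / 2 ^ a` on `[0, 1]` yields
`?(x / (1 + x)) = ?(x) / 2` and `?(1 / (1 + x)) = 1 - ?(x) / 2`, so the range of `?` is dense and
the monotone function `?` is continuous. A cylinder is an interval up to its endpoints, and the
same equation shows that prefixing a digit `a` divides the increment of `?` over it by `2 ^ a`.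
-/

namespace MinkowskiNormality

/-! ### Infinite continued fractions -/

lemma abs_one_div_add_sub_one_div_add_le {𝕜 : Type*} [Field 𝕜] [LinearOrder 𝕜]
    [IsStrictOrderedRing 𝕜] {a x y δ : 𝕜} (ha : 1 ≤ a) (hx : 0 ≤ x) (hy : 0 ≤ y)
    (hxy : |x - y| ≤ δ) : |1 / (a + x) - 1 / (a + y)| ≤ δ / (1 + δ) := by
  have hδ : 0 ≤ δ := (abs_nonneg _).trans hxy
  have hax : 0 < a + x := by linarith
  have hay : 0 < a + y := by linarith
  have hprod : 1 + |x - y| ≤ (a + x) * (a + y) := by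
    have : |x - y| ≤ x + y := abs_le.2 ⟨by linarith, by linarith⟩
    nlinarith [mul_nonneg hx hy]
  calc |1 / (a + x) - 1 / (a + y)| = |x - y| / ((a + x) * (a + y)) := by
        rw [div_sub_div _ _ hax.ne' hay.ne', abs_div, abs_of_pos (mul_pos hax hay), abs_sub_comm x]
        congr 2
        ring
    _ ≤ |x - y| / (1 + |x - y|) := by gcongr
    _ ≤ δ / (1 + δ) := by
        rw [div_le_div_iff₀ (by positivity) (by positivity)]
        linarith

lemma cfEval_mem_Icc {c : List ℕ} (hc : ∀ a ∈ c, 0 < a) : cfEval c ∈ Set.Icc (0 : ℝ) 1 := by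
  induction c with
  | nil => simp [cfEval]
  | cons a c ih =>
    obtain ⟨ha, hc⟩ := List.forall_mem_cons.1 hc
    have ha' : (1 : ℝ) ≤ a := Nat.one_le_cast.2 ha
    have hnonneg := (ih hc).1
    exact ⟨by rw [cfEval]; positivity, (div_le_one (by linarith)).2 (by linarith)⟩

lemma abs_cfEval_append_sub_cfEval_append_le {u s t : List ℕ} (hu : ∀ a ∈ u, 0 < a)
    (hs : ∀ a ∈ s, 0 < a) (ht : ∀ a ∈ t, 0 < a) :
    |cfEval (u ++ s) - cfEval (u ++ t)| ≤ 1 / ((u.length : ℝ) + 1) := by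
  induction u with
  | nil =>
    simpa using abs_sub_le_of_le_of_le (cfEval_mem_Icc hs).1 (cfEval_mem_Icc hs).2
      (cfEval_mem_Icc ht).1 (cfEval_mem_Icc ht).2
  | cons a u ih =>
    obtain ⟨ha, hu⟩ := List.forall_mem_cons.1 hu
    refine (abs_one_div_add_sub_one_div_add_le (Nat.one_le_cast.2 ha)
      (cfEval_mem_Icc (List.forall_mem_append.2 ⟨hu, hs⟩)).1
      (cfEval_mem_Icc (List.forall_mem_append.2 ⟨hu, ht⟩)).1 (ih hu)).trans_eq ?_
    rw [List.length_cons]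
    push_cast
    field_simp

lemma cauchySeq_cfEval_map_range {w : ℕ → ℕ} (hw : ∀ n, 0 < w n) :
    CauchySeq fun n => cfEval ((List.range n).map w) := by
  refine cauchySeq_of_le_tendsto_0 _ ?_ (tendsto_one_div_add_atTop_nhds_zero_nat (𝕜 := ℝ))
  intro n m N hn hm
  obtain ⟨i, rfl⟩ := Nat.exists_eq_add_of_le hn
  obtain ⟨j, rfl⟩ := Nat.exists_eq_add_of_le hm
  have hpos : ∀ l : List ℕ, ∀ a ∈ l.map w, 0 < a := fun l =>
    List.forall_mem_map.2 fun k _ => hw k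
  rw [Real.dist_eq, List.range_add, List.range_add, List.map_append, List.map_append]
  simpa only [List.length_map, List.length_range] using
    abs_cfEval_append_sub_cfEval_append_le (hpos (List.range N)) (hpos _) (hpos _)

/-- The value `[w 0, w 1, …]` of the infinite continued fraction with digits `w`, as the limit of
its convergents. -/
noncomputable def cfLim (w : ℕ → ℕ) : ℝ := limUnder atTop fun n => cfEval ((List.range n).map w)

section cfLim

variable {w : ℕ → ℕ} (hw : ∀ n, 0 < w n)
include hw

lemma tendsto_cfEval_cfLim :
    Tendsto (fun n => cfEval ((List.range n).map w)) atTop (𝓝 (cfLim w)) :=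
  (cauchySeq_cfEval_map_range hw).tendsto_limUnder

lemma cfLim_nonneg : 0 ≤ cfLim w :=
  ge_of_tendsto' (tendsto_cfEval_cfLim hw) fun _ =>
    (cfEval_mem_Icc (List.forall_mem_map.2 fun k _ => hw k)).1

lemma cfLim_eq_inv : cfLim w = ((w 0 : ℝ) + cfLim fun n => w (n + 1))⁻¹ := by
  have htail : ∀ n, 0 < w (n + 1) := fun n => hw (n + 1)
  have hden : (w 0 : ℝ) + cfLim (fun n => w (n + 1)) ≠ 0 :=
    (add_pos_of_pos_of_nonneg (Nat.cast_pos.2 (hw 0)) (cfLim_nonneg htail)).ne'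
  refine tendsto_nhds_unique ((tendsto_cfEval_cfLim hw).comp (tendsto_add_atTop_nat 1))
    ((((tendsto_cfEval_cfLim htail).const_add (w 0 : ℝ)).inv₀ hden).congr fun n => ?_)
  simp [List.range_succ_eq_map, cfEval, Function.comp_def]

lemma cfLim_pos : 0 < cfLim w := by
  rw [cfLim_eq_inv hw]
  exact inv_pos.2 <| add_pos_of_pos_of_nonneg (Nat.cast_pos.2 (hw 0)) (cfLim_nonneg fun n => hw _)

lemma one_lt_head_add_cfLim_tail : 1 < (w 0 : ℝ) + cfLim fun n => w (n + 1) := by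
  have hhead : (1 : ℝ) ≤ w 0 := Nat.one_le_cast.2 (hw 0)
  linarith [cfLim_pos fun n => hw (n + 1)]

lemma cfLim_mem_Ioo : cfLim w ∈ Set.Ioo (0 : ℝ) 1 :=
  ⟨cfLim_pos hw, by
    rw [cfLim_eq_inv hw]
    exact inv_lt_one_of_one_lt₀ (one_lt_head_add_cfLim_tail hw)⟩

end cfLim

lemma cfDigit_fract (x : ℝ) (n : ℕ) : cfDigit (Int.fract x) n = cfDigit x n := by
  cases n with
  | zero => rw [cfDigit_zero_eq, cfDigit_zero_eq, Int.fract_fract]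
  | succ n => rw [cfDigit_succ, cfDigit_succ, Int.fract_fract]

lemma cfDigit_natCast_add (a : ℕ) (x : ℝ) (n : ℕ) : cfDigit (a + x) n = cfDigit x n := by
  rw [← cfDigit_fract, Int.fract_natCast_add, cfDigit_fract]

lemma fract_inv_of_one_lt {𝕜 : Type*} [Field 𝕜] [LinearOrder 𝕜] [IsStrictOrderedRing 𝕜]
    [FloorRing 𝕜] {y : 𝕜} (hy : 1 < y) : Int.fract y⁻¹ = y⁻¹ :=
  Int.fract_eq_self.2 ⟨by positivity, inv_lt_one_of_one_lt₀ hy⟩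

lemma cfDigit_inv_zero {y : ℝ} (hy : 1 < y) : cfDigit y⁻¹ 0 = ⌊y⌋₊ := by
  rw [cfDigit_zero_eq, fract_inv_of_one_lt hy, inv_inv]

lemma cfDigit_inv_succ {y : ℝ} (hy : 1 < y) (n : ℕ) : cfDigit y⁻¹ (n + 1) = cfDigit y n := by
  rw [cfDigit_succ, fract_inv_of_one_lt hy, inv_inv]

lemma natFloor_natCast_add {𝕜 : Type*} [Ring 𝕜] [LinearOrder 𝕜] [IsStrictOrderedRing 𝕜]
    [FloorSemiring 𝕜] (a : ℕ) {z : 𝕜} (hz : z ∈ Set.Ico (0 : 𝕜) 1) : ⌊(a : 𝕜) + z⌋₊ = a := by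
  rw [add_comm, Nat.floor_add_natCast hz.1, Nat.floor_eq_zero.2 hz.2, zero_add]

lemma cfDigit_cfLim {w : ℕ → ℕ} (hw : ∀ n, 0 < w n) (n : ℕ) : cfDigit (cfLim w) n = w n := by
  induction n generalizing w with
  | zero =>
    rw [cfLim_eq_inv hw, cfDigit_inv_zero (one_lt_head_add_cfLim_tail hw),
      natFloor_natCast_add _ (Set.Ioo_subset_Ico_self (cfLim_mem_Ioo fun n => hw (n + 1)))]
  | succ n ih =>
    rw [cfLim_eq_inv hw, cfDigit_inv_succ (one_lt_head_add_cfLim_tail hw), cfDigit_natCast_add,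
      ih fun n => hw (n + 1)]

lemma irrational_of_forall_cfDigit_ne_zero {x : ℝ} (hx : ∀ n, cfDigit x n ≠ 0) :
    Irrational x := by
  rintro ⟨q, hq⟩
  obtain ⟨n, hn⟩ := (GenContFract.terminates_iff_rat x).2 ⟨q, hq.symm⟩
  refine hx n ?_
  rw [cfDigit, GenContFract.partDen_none_iff_s_none.2 hn, Option.getD_none, Nat.floor_zero]

lemma irrational_cfLim {w : ℕ → ℕ} (hw : ∀ n, 0 < w n) : Irrational (cfLim w) :=
  irrational_of_forall_cfDigit_ne_zero fun n => (cfDigit_cfLim hw n).symm ▸ (hw n).ne'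

/-! ### The question mark measure of a cylinder -/

lemma questionMark_natCast_add (a : ℕ) (x : ℝ) : questionMark (a + x) = questionMark x := by
  simp only [questionMark, questionTerm, cfDigit_natCast_add]

lemma questionMark_zero : questionMark 0 = 0 := by
  simp [questionMark, questionTerm_zero_left]

lemma questionMark_inv {y : ℝ} (hy : 1 < y) :
    questionMark y⁻¹ = (2 - questionMark y) / 2 ^ ⌊y⌋₊ := by
  have hdigit : cfDigit y⁻¹ 0 ≠ 0 := by
    rw [cfDigit_inv_zero hy]
    exact (Nat.floor_pos.2 hy.le).ne'
  refine tendsto_nhds_unique ((tendsto_questionSum y⁻¹).comp (tendsto_add_atTop_nat 1))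
    ((((tendsto_questionSum y).const_sub 2).div_const _).congr fun n => ?_)
  rw [Function.comp_apply, questionSum_succ _ hdigit, cfDigit_inv_zero hy, fract_inv_of_one_lt hy,
    inv_inv, one_div_mul_eq_div]

lemma questionCDF_of_mem_Ico {x : ℝ} (hx : x ∈ Set.Ico (0 : ℝ) 1) :
    questionCDF x = questionMark x := by
  rw [questionCDF, if_neg hx.1.not_gt, if_pos hx.2]

lemma questionCDF_of_neg {x : ℝ} (hx : x < 0) : questionCDF x = 0 := if_pos hx

lemma questionCDF_of_one_le {x : ℝ} (hx : 1 ≤ x) : questionCDF x = 1 := by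
  rw [questionCDF, if_neg (zero_le_one.trans hx).not_gt, if_neg hx.not_gt]

lemma questionCDF_zero : questionCDF 0 = 0 := by
  rw [questionCDF_of_mem_Ico ⟨le_rfl, one_pos⟩, questionMark_zero]

lemma questionCDF_one : questionCDF 1 = 1 := questionCDF_of_one_le le_rfl

lemma questionCDF_mem_Icc (x : ℝ) : questionCDF x ∈ Set.Icc (0 : ℝ) 1 := by
  constructor
  · calc 0 = questionCDF (min x (-1)) :=
          (questionCDF_of_neg (min_lt_of_right_lt neg_one_lt_zero)).symm
      _ ≤ questionCDF x := questionCDF_mono (min_le_left _ _)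
  · calc questionCDF x ≤ questionCDF (max x 1) := questionCDF_mono (le_max_left _ _)
      _ = 1 := questionCDF_of_one_le (le_max_right _ _)

lemma questionCDF_inv_natCast_add {a : ℕ} (ha : 0 < a) {z : ℝ} (hz : z ∈ Set.Icc (0 : ℝ) 1) :
    questionCDF (a + z)⁻¹ = (2 - questionCDF z) / 2 ^ a := by
  have ha' : (1 : ℝ) ≤ a := Nat.one_le_cast.2 ha
  have hone_le : 1 ≤ a + z := by linarith [hz.1]
  rcases hone_le.eq_or_lt with heq | hlt
  · obtain rfl : z = 0 := by linarith [hz.1]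
    obtain rfl : a = 1 := by exact_mod_cast (by linarith : (a : ℝ) = 1)
    norm_num [questionCDF_zero, questionCDF_one]
  rw [questionCDF_of_mem_Ico ⟨by positivity, inv_lt_one_of_one_lt₀ hlt⟩, questionMark_inv hlt,
    questionMark_natCast_add]
  rcases hz.2.eq_or_lt with rfl | hz1
  -- `1` is the only point of `[0, 1]` where `questionMark` is not the distribution function.
  · have hmark : questionMark 1 = 0 := by
      simpa [questionMark_zero] using questionMark_natCast_add 1 0
    have hfloor : ⌊(a : ℝ) + 1⌋₊ = a + 1 := by exact_mod_cast Nat.floor_natCast (a + 1)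
    rw [hmark, hfloor, questionCDF_one, pow_succ]
    field_simp
    norm_num
  · rw [natFloor_natCast_add a ⟨hz.1, hz1⟩, questionCDF_of_mem_Ico ⟨hz.1, hz1⟩]

lemma questionCDF_inv_one_add {x : ℝ} (hx : x ∈ Set.Icc (0 : ℝ) 1) :
    questionCDF (1 + x)⁻¹ = 1 - questionCDF x / 2 := by
  have h := questionCDF_inv_natCast_add one_pos hx
  rw [Nat.cast_one] at h
  rw [h]
  ring

lemma questionCDF_div_one_add {x : ℝ} (hx : x ∈ Set.Icc (0 : ℝ) 1) :
    questionCDF (x / (1 + x)) = questionCDF x / 2 := by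
  rcases hx.1.eq_or_lt with rfl | hpos
  · simp [questionCDF_zero]
  have hinv : 1 ≤ x⁻¹ := (one_le_inv₀ hpos).2 hx.2
  set a := ⌊x⁻¹⌋₊
  set z := x⁻¹ - a
  have hz : z ∈ Set.Icc (0 : ℝ) 1 :=
    ⟨sub_nonneg.2 (Nat.floor_le (by positivity)), by linarith [Nat.lt_floor_add_one x⁻¹]⟩
  have hx_eq : x = (a + z)⁻¹ := by rw [add_sub_cancel, inv_inv]
  have hdiv_eq : x / (1 + x) = ((a + 1 : ℕ) + z)⁻¹ := by
    rw [show ((a + 1 : ℕ) + z : ℝ) = x⁻¹ + 1 by push_cast; ring]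
    field_simp
  rw [hdiv_eq, questionCDF_inv_natCast_add a.succ_pos hz, hx_eq,
    questionCDF_inv_natCast_add (Nat.floor_pos.2 hinv) hz, pow_succ, div_div]

lemma exists_abs_questionCDF_sub_le (n : ℕ) {v : ℝ} (hv : v ∈ Set.Icc (0 : ℝ) 1) :
    ∃ x ∈ Set.Icc (0 : ℝ) 1, |questionCDF x - v| ≤ (1 / 2) ^ n := by
  induction n generalizing v with
  | zero =>
    refine ⟨0, ⟨le_rfl, zero_le_one⟩, ?_⟩
    rw [questionCDF_zero, zero_sub, abs_neg, abs_of_nonneg hv.1, pow_zero]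
    exact hv.2
  | succ n ih =>
    have half_abs_le {s : ℝ} (hs : |s| ≤ (1 / 2) ^ n) : |s / 2| ≤ (1 / 2) ^ (n + 1) := by
      rw [abs_div, abs_two, pow_succ]
      linarith
    rcases le_total v (1 / 2) with hle | hge
    · obtain ⟨x, hx, happrox⟩ := ih (v := 2 * v) ⟨by linarith [hv.1], by linarith⟩
      have hpos : 0 < 1 + x := by linarith [hx.1]
      refine ⟨x / (1 + x), ⟨div_nonneg hx.1 hpos.le, (div_le_one hpos).2 (by linarith)⟩, ?_⟩
      rw [questionCDF_div_one_add hx]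
      convert half_abs_le happrox using 2
      ring
    · obtain ⟨x, hx, happrox⟩ := ih (v := 2 - 2 * v) ⟨by linarith [hv.2], by linarith⟩
      have hone_le : 1 ≤ 1 + x := by linarith [hx.1]
      refine ⟨(1 + x)⁻¹, ⟨by positivity, inv_le_one_of_one_le₀ hone_le⟩, ?_⟩
      rw [questionCDF_inv_one_add hx, abs_sub_comm]
      convert half_abs_le happrox using 2
      ring

lemma continuous_questionCDF : Continuous questionCDF := by
  let F : ℝ → Set.Icc (0 : ℝ) 1 := Set.codRestrict questionCDF _ questionCDF_mem_Icc
  have hmono : Monotone F := fun _ _ hxy => questionCDF_mono hxy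
  have hdense : DenseRange F := by
    refine Metric.denseRange_iff.2 fun v r hr => ?_
    obtain ⟨n, hn⟩ := exists_pow_lt_of_lt_one hr (one_half_lt_one (α := ℝ))
    obtain ⟨x, -, hx⟩ := exists_abs_questionCDF_sub_le n v.2
    refine ⟨x, ?_⟩
    rw [dist_comm]
    exact hx.trans_lt hn
  exact continuous_subtype_val.comp (hmono.continuous_of_denseRange hdense)

lemma coe_stieltjesFunction_questionCDF :
    (questionCDF_mono.stieltjesFunction : ℝ → ℝ) = questionCDF := by
  funext x
  rw [Monotone.stieltjesFunction_eq]
  exact continuous_questionCDF.continuousWithinAt.rightLim_eq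

lemma questionMeasure_Icc (p q : ℝ) :
    questionMeasure (Set.Icc p q) = ENNReal.ofReal (questionCDF q - questionCDF p) := by
  rw [questionMeasure, StieltjesFunction.measure_Icc, coe_stieltjesFunction_questionCDF,
    continuous_questionCDF.continuousWithinAt.leftLim_eq]

lemma questionMeasure_Ioo (p q : ℝ) :
    questionMeasure (Set.Ioo p q) = ENNReal.ofReal (questionCDF q - questionCDF p) := by
  rw [questionMeasure, StieltjesFunction.measure_Ioo, coe_stieltjesFunction_questionCDF,
    continuous_questionCDF.continuousWithinAt.leftLim_eq]

lemma cylinder_nil : cylinder [] = Set.Ico 0 1 := by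
  ext
  simp [cylinder]

lemma inv_mem_cylinder_cons {a : ℕ} {d : List ℕ} {y : ℝ} (hy : 1 < y) :
    y⁻¹ ∈ cylinder (a :: d) ↔ ⌊y⌋₊ = a ∧ Int.fract y ∈ cylinder d := by
  have hmem : y⁻¹ ∈ Set.Ico (0 : ℝ) 1 := ⟨by positivity, inv_lt_one_of_one_lt₀ hy⟩
  have hfract : Int.fract y ∈ Set.Ico (0 : ℝ) 1 := ⟨Int.fract_nonneg y, Int.fract_lt_one y⟩
  simp only [cylinder, Set.mem_ofPred_eq, hmem, hfract, true_and, List.length_cons,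
    Nat.forall_lt_succ_left, cfDigit_inv_zero hy, cfDigit_inv_succ hy, cfDigit_fract,
    List.getD_cons_zero, List.getD_cons_succ]

lemma mem_cylinder_cons {a : ℕ} (ha : 0 < a) {d : List ℕ} {y : ℝ} :
    y ∈ cylinder (a :: d) ↔ y < 1 ∧ ∃ z ∈ cylinder d, y = (a + z)⁻¹ := by
  constructor
  · intro hy
    have hy1 : y < 1 := hy.1.2
    have hy0 : 0 < y := by
      refine hy.1.1.lt_of_ne ?_
      rintro rfl
      exact ha.ne (by simpa [cfDigit_zero_left] using hy.2 0 (by simp))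
    have hinv : 1 < y⁻¹ := (one_lt_inv₀ hy0).2 hy1
    rw [← inv_inv y, inv_mem_cylinder_cons hinv] at hy
    refine ⟨hy1, _, hy.2, ?_⟩
    rw [← hy.1, natCast_floor_eq_intCast_floor (by positivity), Int.floor_add_fract, inv_inv]
  · rintro ⟨hy1, z, hz, rfl⟩
    have hpos : (0 : ℝ) < a + z := add_pos_of_pos_of_nonneg (Nat.cast_pos.2 ha) hz.1.1
    rw [inv_mem_cylinder_cons ((inv_lt_one₀ hpos).1 hy1), Int.fract_natCast_add,
      Int.fract_eq_self.2 hz.1]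
    exact ⟨natFloor_natCast_add a hz.1, hz⟩

lemma exists_Ioo_subset_cylinder_subset_Icc {d : List ℕ} (hd : ∀ a ∈ d, 0 < a) :
    ∃ p ∈ Set.Icc (0 : ℝ) 1, ∃ q ∈ Set.Icc (0 : ℝ) 1,
      Set.Ioo p q ⊆ cylinder d ∧ cylinder d ⊆ Set.Icc p q ∧
        questionCDF q - questionCDF p = (1 / 2) ^ d.sum := by
  induction d with
  | nil =>
    refine ⟨0, ⟨le_rfl, zero_le_one⟩, 1, ⟨zero_le_one, le_rfl⟩, ?_⟩
    rw [cylinder_nil]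
    exact ⟨Set.Ioo_subset_Ico_self, Set.Ico_subset_Icc_self,
      by simp [questionCDF_zero, questionCDF_one]⟩
  | cons a d ih =>
    obtain ⟨ha, hd⟩ := List.forall_mem_cons.1 hd
    obtain ⟨p, hp, q, hq, hIoo, hIcc, hCDF⟩ := ih hd
    have ha' : (1 : ℝ) ≤ a := Nat.one_le_cast.2 ha
    have inv_mem {z : ℝ} (hz : z ∈ Set.Icc (0 : ℝ) 1) : (a + z)⁻¹ ∈ Set.Icc (0 : ℝ) 1 :=
      ⟨inv_nonneg.2 (by linarith [hz.1]), inv_le_one_of_one_le₀ (by linarith [hz.1])⟩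
    refine ⟨(a + q)⁻¹, inv_mem hq, (a + p)⁻¹, inv_mem hp, ?_, ?_, ?_⟩
    · intro y hy
      have hy0 : 0 < y := (inv_mem hq).1.trans_lt hy.1
      refine (mem_cylinder_cons ha).2 ⟨hy.2.trans_le (inv_mem hp).2, y⁻¹ - a, hIoo ⟨?_, ?_⟩, ?_⟩
      · linarith [(lt_inv_comm₀ hy0 (by linarith [hp.1])).1 hy.2]
      · linarith [(inv_lt_comm₀ (by linarith [hq.1]) hy0).1 hy.1]
      · rw [add_sub_cancel, inv_inv]
    · intro y hy
      obtain ⟨-, z, hz, rfl⟩ := (mem_cylinder_cons ha).1 hy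
      have hpos {t : ℝ} (ht : 0 ≤ t) : 0 < a + t := by linarith
      exact ⟨inv_anti₀ (hpos hz.1.1) (by linarith [(hIcc hz).2]),
        inv_anti₀ (hpos hp.1) (by linarith [(hIcc hz).1])⟩
    · rw [questionCDF_inv_natCast_add ha hp, questionCDF_inv_natCast_add ha hq, List.sum_cons,
        pow_add, ← hCDF, one_div_pow]
      ring

lemma questionMeasure_cylinder {d : List ℕ} (hd : ∀ a ∈ d, 0 < a) :
    questionMeasure (cylinder d) = ENNReal.ofReal ((1 / 2) ^ d.sum) := by
  obtain ⟨p, -, q, -, hIoo, hIcc, hCDF⟩ := exists_Ioo_subset_cylinder_subset_Icc hd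
  rw [← hCDF]
  exact le_antisymm ((measure_mono hIcc).trans_eq (questionMeasure_Icc p q))
    ((questionMeasure_Ioo p q).symm.trans_le (measure_mono hIoo))


/-! ### Occurrences of a block in a word -/

section Occurrences

variable {α : Type*}

lemma append_singleton_suffix_iff {d u : List α} {a b : α} :
    d ++ [a] <:+ u ++ [b] ↔ d <:+ u ∧ a = b := by
  rw [List.suffix_append_inj_of_length_eq (s₁ := [a]) (s₂ := [b]) rfl, List.singleton_inj]

variable [DecidableEq α]

/-- The number of occurrences of the block `d` in the word `c`. An occurrence is counted at its
last letter, so the empty block has `c.length` occurrences. -/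
def occ (d c : List α) : ℕ := ((Finset.range c.length).filter fun i => d <:+ c.take (i + 1)).card

lemma occ_nil_left (c : List α) : occ [] c = c.length := by simp [occ]

lemma occ_le_length (d c : List α) : occ d c ≤ c.length :=
  (Finset.card_filter_le _ _).trans_eq (Finset.card_range _)

lemma occ_append (d x y : List α) :
    occ d (x ++ y) =
      occ d x + ((Finset.range y.length).filter fun i => d <:+ x ++ y.take (i + 1)).card := by
  have htake (i : ℕ) : (x ++ y).take (x.length + i + 1) = x ++ y.take (i + 1) := by
    rw [add_assoc, List.take_length_add_append]
  simp only [occ, Finset.card_filter, List.length_append, Finset.sum_range_add, htake]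
  congr 1
  refine Finset.sum_congr rfl fun i hi => ?_
  rw [List.take_append_of_le_length (Nat.succ_le_of_lt (Finset.mem_range.1 hi))]

lemma occ_concat (d u : List α) (b : α) :
    occ d (u ++ [b]) = occ d u + if d <:+ u ++ [b] then 1 else 0 := by
  simp [occ_append, apply_ite Finset.card]

lemma occ_add_occ_le_occ_append (d x y : List α) : occ d x + occ d y ≤ occ d (x ++ y) := by
  rw [occ_append]
  refine Nat.add_le_add_left (Finset.card_le_card ?_) _
  exact Finset.monotone_filter_right _ fun _ _ h => List.suffix_append_of_suffix h

lemma occ_append_le (d x y : List α) : occ d (x ++ y) ≤ occ d x + occ d y + d.length := by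
  rw [occ_append, add_assoc]
  gcongr
  calc _ ≤ ((Finset.range y.length).filter (fun i => d <:+ y.take (i + 1)) ∪
          Finset.range d.length).card := Finset.card_le_card fun i hi => ?_
    _ ≤ occ d y + d.length := (Finset.card_union_le _ _).trans_eq (by rw [occ, Finset.card_range])
  simp only [Finset.mem_union, Finset.mem_filter, Finset.mem_range] at hi ⊢
  refine (lt_or_ge i d.length).symm.imp_left fun hlen => ⟨hi.1, ?_⟩
  refine List.suffix_of_suffix_length_le hi.2 (List.suffix_append _ _) ?_
  rw [List.length_take]
  lia

/-- The deviation, in the word `c`, of the number of occurrences of the block `d, a` from the share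
`p` of the number of occurrences of `d`. -/
def deviation (p : ℝ) (d : List α) (a : α) (c : List α) : ℝ := occ (d ++ [a]) c - p * occ d c

lemma deviation_concat (p : ℝ) (d : List α) (a : α) (u : List α) (b : α) :
    deviation p d a (u ++ [b]) = deviation p d a u + (if d <:+ u ∧ a = b then 1 else 0) -
      if d <:+ u ++ [b] then p else 0 := by
  simp only [deviation, occ_concat, append_singleton_suffix_iff]
  push_cast
  split_ifs <;> ring

lemma deviation_nil (p : ℝ) (d : List α) (a : α) : deviation p d a [] = 0 := by
  simp [deviation, occ]

section

variable {p : ℝ} (hp : p ∈ Set.Icc (0 : ℝ) 1)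
include hp

lemma abs_deviation_le_length (d : List α) (a : α) (c : List α) :
    |deviation p d a c| ≤ c.length := by
  have hda : (occ (d ++ [a]) c : ℝ) ≤ c.length := Nat.cast_le.2 (occ_le_length _ c)
  have hd : p * occ d c ≤ c.length := calc
    p * occ d c ≤ occ d c := mul_le_of_le_one_left (Nat.cast_nonneg _) hp.2
    _ ≤ c.length := Nat.cast_le.2 (occ_le_length _ c)
  exact abs_sub_le_of_nonneg_of_le (Nat.cast_nonneg _) hda
    (mul_nonneg hp.1 (Nat.cast_nonneg _)) hd

lemma abs_deviation_append_sub_le (d : List α) (a : α) (x y : List α) :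
    |deviation p d a (x ++ y) - (deviation p d a x + deviation p d a y)| ≤ d.length + 1 := by
  have excess_mem (e : List α) :
      (occ e (x ++ y) - (occ e x + occ e y) : ℝ) ∈ Set.Icc (0 : ℝ) e.length := by
    constructor
    · exact sub_nonneg.2 (by exact_mod_cast occ_add_occ_le_occ_append e x y)
    · exact sub_le_iff_le_add'.2 (by exact_mod_cast occ_append_le e x y)
  obtain ⟨hda₀, hda⟩ := excess_mem (d ++ [a])
  obtain ⟨hd₀, hd⟩ := excess_mem d
  rw [List.length_append, List.length_singleton, Nat.cast_add_one] at hda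
  rw [show deviation p d a (x ++ y) - (deviation p d a x + deviation p d a y) =
    (occ (d ++ [a]) (x ++ y) - (occ (d ++ [a]) x + occ (d ++ [a]) y)) -
      p * (occ d (x ++ y) - (occ d x + occ d y)) by simp only [deviation]; ring]
  exact abs_sub_le_of_nonneg_of_le hda₀ hda (mul_nonneg hp.1 hd₀)
    ((mul_le_of_le_one_left hd₀ hp.2).trans (hd.trans (by linarith)))

lemma abs_deviation_take_flatten_le (d : List α) (a : α) {B : ℕ} {cs : List (List α)}
    (hB : ∀ c ∈ cs, c.length ≤ B) (n : ℕ) :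
    |deviation p d a (cs.flatten.take n)| ≤
      (cs.map fun c => |deviation p d a c| + (d.length + 1)).sum + B := by
  induction cs generalizing n with
  | nil => simp [deviation_nil]
  | cons c cs ih =>
    obtain ⟨hc, hcs⟩ := List.forall_mem_cons.1 hB
    rw [List.flatten_cons, List.map_cons, List.sum_cons]
    rcases le_total n c.length with hn | hn
    · rw [List.take_append_of_le_length hn]
      have hlen : ((c.take n).length : ℝ) ≤ B :=
        Nat.cast_le.2 ((List.length_take_le' n c).trans hc)
      have hsum : 0 ≤ (cs.map fun c => |deviation p d a c| + ((d.length : ℝ) + 1)).sum :=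
        List.sum_nonneg (List.forall_mem_map.2 fun _ _ => by positivity)
      linarith [abs_deviation_le_length hp d a (c.take n), abs_nonneg (deviation p d a c),
        (d.length.cast_nonneg : (0 : ℝ) ≤ d.length)]
    · rw [List.take_append, List.take_of_length_le hn]
      set y := cs.flatten.take (n - c.length)
      have happ := abs_deviation_append_sub_le hp d a c y
      have htri := abs_sub_abs_le_abs_sub (deviation p d a (c ++ y))
        (deviation p d a c + deviation p d a y)
      linarith [ih hcs (n - c.length), abs_add_le (deviation p d a c) (deviation p d a y)]

end

lemma tendsto_occ_div_of_tendsto_deviation_div {p : α → ℝ} {w : ℕ → α} {d : List α}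
    (h : ∀ a ∈ d, ∀ e : List α,
      Tendsto (fun n : ℕ => deviation (p a) e a ((List.range n).map w) / n) atTop (𝓝 0)) :
    Tendsto (fun n : ℕ => (occ d ((List.range n).map w) : ℝ) / n) atTop (𝓝 (d.map p).prod) := by
  induction d using List.reverseRecOn with
  | nil =>
    refine tendsto_const_nhds.congr' ?_
    filter_upwards [eventually_ne_atTop 0] with n hn
    simp [occ_nil_left, hn]
  | append_singleton d a ih =>
    obtain ⟨hd, ha⟩ := List.forall_mem_append.1 h
    have hlim := (ha a (List.mem_singleton_self a) d).add ((ih hd).const_mul (p a))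
    rw [List.map_append, List.prod_append, List.map_singleton, List.prod_singleton, mul_comm,
      ← zero_add (p a * _)]
    refine hlim.congr fun n => ?_
    rw [deviation]
    ring

end Occurrences

lemma prod_map_pow_eq_pow_sum {M : Type*} [Monoid M] (x : M) (d : List ℕ) :
    (d.map fun a => x ^ a).prod = x ^ d.sum := by
  induction d with
  | nil => simp
  | cons a d ih => rw [List.map_cons, List.prod_cons, ih, List.sum_cons, pow_add]

lemma suffix_map_range_iff {α : Type*} {w : ℕ → α} {d : List α} {m : ℕ} (b : α) :
    d <:+ (List.range m).map w ↔
      d.length ≤ m ∧ ∀ j < d.length, w (m - d.length + j) = d.getD j b := by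
  constructor
  · intro h
    refine ⟨by simpa using h.length_le, fun j hj => ?_⟩
    rw [List.getD_eq_getElem _ _ hj, h.getElem hj]
    simp
  · rintro ⟨hlen, h⟩
    rw [List.suffix_iff_eq_drop]
    refine List.ext_getElem (by simp; lia) fun j hj _ => ?_
    rw [← List.getD_eq_getElem _ b hj, ← h j hj]
    simp

lemma blockCount_eq_occ (n : ℕ) (x : ℝ) {d : List ℕ} (hd : d ≠ []) :
    blockCount n x d = occ d ((List.range n).map (cfDigit x)) := by
  obtain ⟨k, hk⟩ : ∃ k, d.length = k + 1 :=
    Nat.exists_eq_succ_of_ne_zero (List.length_pos_iff.2 hd).ne'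
  have hocc : ∀ m, m + 1 ≤ n → (d <:+ ((List.range n).map (cfDigit x)).take (m + 1) ↔
      k ≤ m ∧ ∀ j < d.length, cfDigit x (m - k + j) = d.getD j 0) := by
    intro m hm
    rw [← List.map_take, List.take_range, min_eq_left hm, suffix_map_range_iff 0, hk,
      Nat.add_le_add_iff_right, Nat.add_sub_add_right]
  unfold blockCount occ
  -- The occurrence with first letter at `i` has its last letter at `i + k`.
  refine Finset.card_nbij' (· + k) (· - k) ?_ ?_ (fun i _ => Nat.add_sub_cancel i k) ?_
  all_goals
    intro i hi
    simp only [Finset.coe_filter, Finset.mem_range, Set.mem_ofPred_eq, List.length_map,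
      List.length_range] at hi ⊢
  · have hik : i + k + 1 ≤ n := by lia
    rw [hocc _ hik, Nat.add_sub_cancel]
    exact ⟨hik, Nat.le_add_left k i, hi.2.2⟩
  · obtain ⟨hki, hdigit⟩ := (hocc i hi.1).1 hi.2
    exact ⟨by lia, by lia, hdigit⟩
  · exact Nat.sub_add_cancel ((hocc i hi.1).1 hi.2).1

lemma minkowskiNormal_cfLim {w : ℕ → ℕ} (hw : ∀ n, 0 < w n)
    (hfreq : ∀ d : List ℕ, (∀ a ∈ d, 0 < a) →
      Tendsto (fun n : ℕ => (occ d ((List.range n).map w) : ℝ) / n) atTop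
        (𝓝 ((1 / 2) ^ d.sum))) :
    MinkowskiNormal (cfLim w) := by
  refine ⟨Set.Ioo_subset_Ico_self (cfLim_mem_Ioo hw), fun d hd hpos => ?_⟩
  have hmeasure := questionMeasure_cylinder hpos
  refine ⟨?_, hmeasure⟩
  rw [hmeasure, ENNReal.toReal_ofReal (by positivity)]
  simpa only [blockCount_eq_occ _ _ hd, funext (cfDigit_cfLim hw)] using hfreq d hpos

/-! ### A martingale on the Farey tree -/

/-- The correction to the deviation for an unfinished digit: the probability that a digit which has
`r` units so far, following `u`, completes an occurrence of the block `d, a`, when each further unit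
belongs to the same digit with probability `1 / 2`. -/
noncomputable def pending (d : List ℕ) (a : ℕ) (u : List ℕ) (r : ℕ) : ℝ :=
  if d <:+ u ∧ r ≤ a then (1 / 2) ^ (a + 1 - r) else 0

lemma half_pow_mem_Icc (n : ℕ) : (1 / 2 : ℝ) ^ n ∈ Set.Icc (0 : ℝ) 1 :=
  ⟨by positivity, pow_le_one₀ (by norm_num) (by norm_num)⟩

lemma pending_mem_Icc (d : List ℕ) (a : ℕ) (u : List ℕ) (r : ℕ) :
    pending d a u r ∈ Set.Icc (0 : ℝ) 1 := by
  unfold pending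
  split_ifs
  · exact half_pow_mem_Icc _
  · exact ⟨le_rfl, zero_le_one⟩

lemma pending_one {a : ℕ} (ha : 0 < a) (d u : List ℕ) :
    pending d a u 1 = if d <:+ u then (1 / 2) ^ a else 0 := by
  simp [pending, Nat.one_le_iff_ne_zero.2 ha.ne']

/-- Given one more coin toss, the digit either gets a further unit or ends with `r` units. -/
lemma two_mul_pending (d : List ℕ) (a : ℕ) (u : List ℕ) (r : ℕ) :
    2 * pending d a u r = pending d a u (r + 1) + if d <:+ u ∧ a = r then 1 else 0 := by
  unfold pending
  by_cases hd : d <:+ u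
  · simp only [hd, true_and]
    rcases lt_trichotomy r a with h | rfl | h
    · rw [if_pos h.le, if_pos (Nat.succ_le_of_lt h), if_neg h.ne', Nat.add_sub_add_right,
        Nat.sub_add_comm h.le, pow_succ]
      ring
    · norm_num
    · rw [if_neg h.not_ge, if_neg (by lia), if_neg h.ne]
      norm_num
  · simp [hd]

/-- The deviation of a node of the Farey tree from the share `(1 / 2) ^ a`, corrected for its last
digit so that it becomes a martingale along the tree. The last digit `r + 1` of a node counts as an
unfinished digit with `r` units: it is `r` that `splitLast` writes down. -/
noncomputable def martingaleDev (d : List ℕ) (a : ℕ) (c : List ℕ) : ℝ :=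
  deviation ((1 / 2) ^ a) d a c.dropLast + pending d a c.dropLast (c.getLastD 0 - 1)

lemma martingaleDev_concat (d : List ℕ) (a : ℕ) (u : List ℕ) (r : ℕ) :
    martingaleDev d a (u ++ [r + 1]) = deviation ((1 / 2) ^ a) d a u + pending d a u r := by
  simp [martingaleDev]

lemma incrLast_concat (u : List ℕ) (r : ℕ) : incrLast (u ++ [r]) = u ++ [r + 1] := by
  simp [incrLast]

lemma splitLast_concat (u : List ℕ) (r : ℕ) : splitLast (u ++ [r + 1]) = u ++ [r] ++ [2] := by
  simp [splitLast]

lemma martingaleDev_incrLast_add_splitLast {a : ℕ} (ha : 0 < a) (d u : List ℕ) (r : ℕ) :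
    martingaleDev d a (incrLast (u ++ [r + 1])) + martingaleDev d a (splitLast (u ++ [r + 1])) =
      2 * martingaleDev d a (u ++ [r + 1]) := by
  rw [incrLast_concat, splitLast_concat, martingaleDev_concat, martingaleDev_concat,
    martingaleDev_concat, deviation_concat, pending_one ha, mul_add, two_mul_pending]
  ring

lemma abs_martingaleDev_incrLast_sub_le (d : List ℕ) (a : ℕ) (u : List ℕ) (r : ℕ) :
    |martingaleDev d a (incrLast (u ++ [r + 1])) - martingaleDev d a (u ++ [r + 1])| ≤ 1 := by
  rw [incrLast_concat, martingaleDev_concat, martingaleDev_concat, add_sub_add_left_eq_sub]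
  exact abs_sub_le_of_nonneg_of_le (pending_mem_Icc ..).1 (pending_mem_Icc ..).2
    (pending_mem_Icc ..).1 (pending_mem_Icc ..).2

lemma martingaleDev_sq_add_sq_le {a : ℕ} (ha : 0 < a) (d u : List ℕ) (r : ℕ) :
    martingaleDev d a (incrLast (u ++ [r + 1])) ^ 2 +
        martingaleDev d a (splitLast (u ++ [r + 1])) ^ 2 ≤
      2 * martingaleDev d a (u ++ [r + 1]) ^ 2 + 2 := by
  have hstep := (sq_le_one_iff_abs_le_one _).2 (abs_martingaleDev_incrLast_sub_le d a u r)
  rw [eq_sub_of_add_eq' (martingaleDev_incrLast_add_splitLast ha d u r)]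
  linarith

lemma abs_deviation_concat_le (d : List ℕ) (a : ℕ) (u : List ℕ) (r : ℕ) :
    |deviation ((1 / 2) ^ a) d a (u ++ [r + 1])| ≤ |martingaleDev d a (u ++ [r + 1])| + 2 := by
  have hdiff : |deviation ((1 / 2) ^ a) d a (u ++ [r + 1]) -
      martingaleDev d a (u ++ [r + 1])| ≤ 2 := by
    obtain ⟨hpending₀, hpending₁⟩ := pending_mem_Icc d a u r
    obtain ⟨hpow₀, hpow₁⟩ := half_pow_mem_Icc a
    rw [deviation_concat, martingaleDev_concat, abs_le]
    split_ifs <;> constructor <;> linarith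
  linarith [abs_sub_abs_le_abs_sub (deviation ((1 / 2) ^ a) d a (u ++ [r + 1]))
    (martingaleDev d a (u ++ [r + 1]))]

/-! ### Sums over a level of the Farey tree -/

lemma mem_fareyChildren {b c : List ℕ} (hc : c ∈ fareyChildren b) :
    c = incrLast b ∨ c = splitLast b := by
  unfold fareyChildren at hc
  split_ifs at hc
  · simpa using hc
  · simpa [or_comm] using hc

lemma exists_eq_concat_of_mem_fareyLevel {l : ℕ} {c : List ℕ} (hc : c ∈ fareyLevel l) :
    ∃ u r, c = u ++ [r + 1] ∧ 0 < r ∧ (∀ a ∈ u, 0 < a) ∧ u.length ≤ l := by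
  induction l generalizing c with
  | zero => exact ⟨[], 1, by simpa [fareyLevel] using hc, one_pos, by simp, le_rfl⟩
  | succ l ih =>
    obtain ⟨b, hb, hcb⟩ := List.mem_flatMap.1 hc
    obtain ⟨u, r, rfl, hr, hu, hlen⟩ := ih hb
    rcases mem_fareyChildren hcb with rfl | rfl
    · exact ⟨u, r + 1, incrLast_concat .., r.succ_pos, hu, hlen.trans l.le_succ⟩
    · exact ⟨u ++ [r], 1, splitLast_concat .., one_pos,
        List.forall_mem_append.2 ⟨hu, by simpa using hr⟩, by simpa using hlen⟩

lemma sum_map_fareyChildren {M : Type*} [AddCommMonoid M] (g : List ℕ → M) (c : List ℕ) :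
    ((fareyChildren c).map g).sum = g (incrLast c) + g (splitLast c) := by
  unfold fareyChildren
  split_ifs
  · simp
  · simp [add_comm]

lemma sum_map_fareyLevel_succ {M : Type*} [AddCommMonoid M] (g : List ℕ → M) (l : ℕ) :
    ((fareyLevel (l + 1)).map g).sum =
      ((fareyLevel l).map fun c => g (incrLast c) + g (splitLast c)).sum := by
  simp only [fareyLevel, List.flatMap_def, List.map_flatten, List.sum_flatten, List.map_map,
    Function.comp_def, sum_map_fareyChildren]

lemma length_fareyLevel (l : ℕ) : (fareyLevel l).length = 2 ^ l := by
  induction l with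
  | zero => rfl
  | succ l ih =>
    have hchildren (c : List ℕ) : (fareyChildren c).length = 2 := by
      unfold fareyChildren
      split_ifs <;> rfl
    simp [fareyLevel, List.length_flatMap, hchildren, ih, pow_succ]

lemma two_mul_sum_length_fareyLevel (l : ℕ) :
    2 * ((fareyLevel l).map List.length).sum = 2 ^ l * (l + 2) := by
  induction l with
  | zero => rfl
  | succ l ih =>
    have hchildren : (fareyLevel l).map (fun c => (incrLast c).length + (splitLast c).length) =
        (fareyLevel l).map fun c => 2 * c.length + 1 := by
      refine List.map_congr_left fun c hc => ?_
      obtain ⟨u, r, rfl, -⟩ := exists_eq_concat_of_mem_fareyLevel hc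
      simp only [incrLast_concat, splitLast_concat, List.length_append, List.length_singleton]
      ring
    rw [sum_map_fareyLevel_succ, hchildren, List.sum_map_add, List.sum_map_mul_left, ih,
      List.map_const', List.sum_replicate, length_fareyLevel, smul_eq_mul]
    ring

lemma sum_map_fareyLevel_le {g : List ℕ → ℝ} {K : ℝ}
    (hg : ∀ u r, g (incrLast (u ++ [r + 1])) + g (splitLast (u ++ [r + 1])) ≤
      2 * g (u ++ [r + 1]) + 2 * K) (l : ℕ) :
    ((fareyLevel l).map g).sum ≤ 2 ^ l * (g [2] + l * K) := by
  induction l with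
  | zero => simp [fareyLevel]
  | succ l ih =>
    calc ((fareyLevel (l + 1)).map g).sum
        = ((fareyLevel l).map fun c => g (incrLast c) + g (splitLast c)).sum :=
          sum_map_fareyLevel_succ g l
      _ ≤ ((fareyLevel l).map fun c => 2 * g c + 2 * K).sum := by
          refine List.sum_le_sum fun c hc => ?_
          obtain ⟨u, r, rfl, -⟩ := exists_eq_concat_of_mem_fareyLevel hc
          exact hg u r
      _ = 2 * ((fareyLevel l).map g).sum + 2 ^ l * (2 * K) := by
          rw [List.sum_map_add, List.sum_map_mul_left, List.map_const', List.sum_replicate,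
            length_fareyLevel, nsmul_eq_mul, Nat.cast_pow, Nat.cast_ofNat]
      _ ≤ 2 * (2 ^ l * (g [2] + l * K)) + 2 ^ l * (2 * K) := by gcongr
      _ = 2 ^ (l + 1) * (g [2] + (l + 1 : ℕ) * K) := by
          push_cast
          ring

lemma sum_martingaleDev_sq_fareyLevel_le {a : ℕ} (ha : 0 < a) (d : List ℕ) (l : ℕ) :
    ((fareyLevel l).map fun c => martingaleDev d a c ^ 2).sum ≤ 2 ^ l * (l + 1) := by
  have hroot : martingaleDev d a [2] ^ 2 ≤ 1 := by
    have hpending : martingaleDev d a [2] = pending d a [] 1 := by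
      simpa [deviation_nil] using martingaleDev_concat d a [] 1
    rw [hpending]
    exact pow_le_one₀ (pending_mem_Icc ..).1 (pending_mem_Icc ..).2
  refine (sum_map_fareyLevel_le (K := 1) (fun u r => ?_) l).trans ?_
  · simpa only [mul_one] using martingaleDev_sq_add_sq_le ha d u r
  · rw [mul_one, add_comm]
    gcongr

lemma sq_sum_map_le_length_mul_sum_map_sq {ι R : Type*} [Semiring R] [LinearOrder R]
    [IsStrictOrderedRing R] [ExistsAddOfLE R] (s : List ι) (f : ι → R) :
    (s.map f).sum ^ 2 ≤ s.length * (s.map fun c => f c ^ 2).sum := by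
  have hcauchy :=
    sq_sum_le_card_mul_sum_sq (s := Finset.univ) (f := fun i : Fin s.length => f s[(i : ℕ)])
  rwa [Finset.card_fin, Fin.sum_univ_fun_getElem s f,
    Fin.sum_univ_fun_getElem s fun c => f c ^ 2] at hcauchy

lemma sum_abs_martingaleDev_fareyLevel_le {a : ℕ} (ha : 0 < a) (d : List ℕ) (l : ℕ) :
    ((fareyLevel l).map fun c => |martingaleDev d a c|).sum ≤ 2 ^ l * √(l + 1) := by
  refine le_of_sq_le_sq ?_ (by positivity)
  calc ((fareyLevel l).map fun c => |martingaleDev d a c|).sum ^ 2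
      ≤ 2 ^ l * ((fareyLevel l).map fun c => martingaleDev d a c ^ 2).sum := by
        simpa [length_fareyLevel] using
          sq_sum_map_le_length_mul_sum_map_sq (fareyLevel l) fun c => |martingaleDev d a c|
    _ ≤ 2 ^ l * (2 ^ l * (l + 1)) := by
        gcongr
        exact sum_martingaleDev_sq_fareyLevel_le ha d l
    _ = (2 ^ l * √(l + 1)) ^ 2 := by
        rw [mul_pow, Real.sq_sqrt (by positivity)]
        ring

lemma sum_abs_deviation_fareyLevel_le {a : ℕ} (ha : 0 < a) (d : List ℕ) (K : ℝ) (l : ℕ) :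
    ((fareyLevel l).map fun c => |deviation ((1 / 2) ^ a) d a c| + K).sum ≤
      2 ^ l * (√(l + 1) + 2 + K) := by
  calc ((fareyLevel l).map fun c => |deviation ((1 / 2) ^ a) d a c| + K).sum
      ≤ ((fareyLevel l).map fun c => |martingaleDev d a c| + (2 + K)).sum := by
        refine List.sum_le_sum fun c hc => ?_
        obtain ⟨u, r, rfl, -⟩ := exists_eq_concat_of_mem_fareyLevel hc
        linarith [abs_deviation_concat_le d a u r]
    _ = ((fareyLevel l).map fun c => |martingaleDev d a c|).sum + 2 ^ l * (2 + K) := by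
        rw [List.sum_map_add, List.map_const', List.sum_replicate, length_fareyLevel,
          nsmul_eq_mul, Nat.cast_pow, Nat.cast_ofNat]
    _ ≤ 2 ^ l * (√(l + 1) + 2 + K) := by
        linarith [sum_abs_martingaleDev_fareyLevel_le ha d l]

/-! ### The concatenation of the levels -/

/-- The nodes of the levels `0, …, L - 1` of the Farey tree, top-down, left-right. -/
def fareyNodes (L : ℕ) : List (List ℕ) := (List.range L).flatMap fareyLevel

lemma fareyNodes_succ (L : ℕ) : fareyNodes (L + 1) = fareyNodes L ++ fareyLevel L := by
  simp [fareyNodes, List.range_succ]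

lemma fareyPrefix_eq_flatten (L : ℕ) : fareyPrefix L = (fareyNodes L).flatten := by
  induction L with
  | zero => rfl
  | succ L ih => rw [fareyPrefix, fareyNodes_succ, List.flatten_append, ih]

lemma length_le_of_mem_fareyNodes {L : ℕ} {c : List ℕ} (hc : c ∈ fareyNodes L) :
    c.length ≤ L := by
  obtain ⟨l, hl, hcl⟩ := List.mem_flatMap.1 hc
  obtain ⟨u, r, rfl, -, -, hu⟩ := exists_eq_concat_of_mem_fareyLevel hcl
  rw [List.length_append, List.length_singleton]
  exact Nat.succ_le_of_lt (hu.trans_lt (List.mem_range.1 hl))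

lemma pos_of_mem_fareyPrefix {L a : ℕ} (h : a ∈ fareyPrefix L) : 0 < a := by
  rw [fareyPrefix_eq_flatten] at h
  obtain ⟨c, hc, hac⟩ := List.mem_flatten.1 h
  obtain ⟨l, -, hcl⟩ := List.mem_flatMap.1 hc
  obtain ⟨u, r, rfl, -, hu, -⟩ := exists_eq_concat_of_mem_fareyLevel hcl
  exact List.forall_mem_append.2 ⟨hu, by simp⟩ a hac

lemma two_mul_length_fareyPrefix (L : ℕ) : 2 * (fareyPrefix L).length = 2 ^ L * L := by
  induction L with
  | zero => rfl
  | succ L ih =>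
    rw [fareyPrefix, List.length_append, List.length_flatten, mul_add, ih,
      two_mul_sum_length_fareyLevel]
    ring

lemma sum_abs_deviation_fareyNodes_le {a : ℕ} (ha : 0 < a) (d : List ℕ) {K : ℝ} (hK : 0 ≤ K)
    (L : ℕ) :
    ((fareyNodes L).map fun c => |deviation ((1 / 2) ^ a) d a c| + K).sum ≤
      2 ^ L * (√L + 2 + K) := by
  induction L with
  | zero =>
    simp only [fareyNodes, List.range_zero, List.flatMap_nil, List.map_nil, List.sum_nil]
    positivity
  | succ L ih =>
    rw [fareyNodes_succ, List.map_append, List.sum_append]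
    calc _ ≤ 2 ^ L * (√L + 2 + K) + 2 ^ L * (√(L + 1) + 2 + K) :=
          add_le_add ih (sum_abs_deviation_fareyLevel_le ha d K L)
      _ ≤ 2 ^ L * (√(L + 1) + 2 + K) + 2 ^ L * (√(L + 1) + 2 + K) := by
          gcongr
          linarith
      _ = 2 ^ (L + 1) * (√(L + 1 : ℕ) + 2 + K) := by
          push_cast
          ring

lemma fareyPrefix_prefix {L M : ℕ} (h : L ≤ M) : fareyPrefix L <+: fareyPrefix M := by
  induction M, h using Nat.le_induction with
  | base => exact List.prefix_rfl
  | succ M _ ih => exact ih.trans (List.prefix_append _ _)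

lemma fareyDigit_eq_getElem {n L : ℕ} (h : n < (fareyPrefix L).length) :
    fareyDigit n = (fareyPrefix L)[n] := by
  have h' := lt_length_fareyPrefix n
  rw [fareyDigit, List.getD_eq_getElem _ _ h']
  rcases le_total L (n + 1) with hL | hL
  · exact ((fareyPrefix_prefix hL).getElem h).symm
  · exact (fareyPrefix_prefix hL).getElem h'

lemma fareyDigit_pos (n : ℕ) : 0 < fareyDigit n := by
  rw [fareyDigit_eq_getElem (lt_length_fareyPrefix n)]
  exact pos_of_mem_fareyPrefix (List.getElem_mem _)

lemma map_fareyDigit_range {n L : ℕ} (h : n ≤ (fareyPrefix L).length) :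
    (List.range n).map fareyDigit = (fareyPrefix L).take n := by
  refine List.ext_getElem (by simpa using h) fun i _ hi => ?_
  rw [List.getElem_map, List.getElem_range, List.getElem_take, fareyDigit_eq_getElem]

/-! ### The frequencies along the concatenation -/

lemma exists_tendsto_le_lt_succ {β : Type*} [LinearOrder β] [OrderBot β] {s : ℕ → β}
    (hs : Monotone s) (hzero : s 0 = ⊥) (hunbounded : ∀ n, ∃ l, n < s l) :
    ∃ L : β → ℕ, Tendsto L atTop atTop ∧ ∀ n, s (L n) ≤ n ∧ n < s (L n + 1) := by
  have hex (n : β) : ∃ l, ¬n < s l ∧ n < s (l + 1) :=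
    Nat.exists_not_and_succ_of_not_zero_of_exists (by simp [hzero]) (hunbounded n)
  choose L hle hlt using hex
  refine ⟨L, tendsto_atTop.2 fun b => ?_, fun n => ⟨not_lt.1 (hle n), hlt n⟩⟩
  filter_upwards [eventually_ge_atTop (s b)] with n hn
  by_contra! hLb
  exact (hlt n).not_ge ((hs (Nat.succ_le_of_lt hLb)).trans hn)

lemma abs_deviation_fareyDigit_le {a : ℕ} (ha : 0 < a) (d : List ℕ) {n L : ℕ}
    (hn : n ≤ (fareyPrefix L).length) :
    |deviation ((1 / 2) ^ a) d a ((List.range n).map fareyDigit)| ≤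
      2 ^ L * (√L + (d.length + 4)) := by
  have hL : (L : ℝ) ≤ 2 ^ L := mod_cast Nat.lt_two_pow_self.le
  rw [map_fareyDigit_range hn, fareyPrefix_eq_flatten]
  calc _ ≤ ((fareyNodes L).map fun c =>
        |deviation ((1 / 2) ^ a) d a c| + ((d.length : ℝ) + 1)).sum + L :=
        abs_deviation_take_flatten_le (half_pow_mem_Icc a) d a
          (fun _ => length_le_of_mem_fareyNodes) n
    _ ≤ 2 ^ L * (√L + 2 + (d.length + 1)) + 2 ^ L :=
        add_le_add (sum_abs_deviation_fareyNodes_le ha d (by positivity) L) hL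
    _ = 2 ^ L * (√L + (d.length + 4)) := by ring

lemma tendsto_sqrt_succ_add_div (C : ℝ) :
    Tendsto (fun l : ℕ => (√(l + 1 : ℕ) + C) / l) atTop (𝓝 0) := by
  have hsqrt : Tendsto (fun l : ℕ => √((l : ℝ)⁻¹ + (l : ℝ)⁻¹ ^ 2)) atTop (𝓝 0) := by
    have hinv : Tendsto (fun l : ℕ => (l : ℝ)⁻¹) atTop (𝓝 0) := tendsto_inv_atTop_nhds_zero_nat
    simpa using (hinv.add (hinv.pow 2)).sqrt
  have hsum := hsqrt.add (tendsto_const_div_atTop_nhds_zero_nat C)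
  rw [zero_add] at hsum
  refine hsum.congr' ?_
  filter_upwards [eventually_gt_atTop 0] with l hl
  have hl' : (0 : ℝ) < l := Nat.cast_pos.2 hl
  have hradicand : (l : ℝ)⁻¹ + (l : ℝ)⁻¹ ^ 2 = (l + 1) / l ^ 2 := by field_simp
  rw [hradicand, Real.sqrt_div' _ (sq_nonneg _), Real.sqrt_sq hl'.le, ← add_div, Nat.cast_add_one]

lemma tendsto_deviation_fareyDigit {a : ℕ} (ha : 0 < a) (d : List ℕ) :
    Tendsto (fun n : ℕ => deviation ((1 / 2) ^ a) d a ((List.range n).map fareyDigit) / n) atTop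
      (𝓝 0) := by
  obtain ⟨L, hL, hlevel⟩ := exists_tendsto_le_lt_succ (s := fun l => (fareyPrefix l).length)
    (fun _ _ h => (fareyPrefix_prefix h).length_le) rfl
    fun n => ⟨n + 1, lt_length_fareyPrefix n⟩
  have hbound := ((tendsto_sqrt_succ_add_div (d.length + 4)).const_mul 4).comp hL
  rw [mul_zero] at hbound
  refine squeeze_zero_norm' ?_ hbound
  filter_upwards [hL.eventually_gt_atTop 0] with n hLn
  have hn : (2 : ℝ) ^ L n * L n ≤ 2 * n := by
    exact_mod_cast (two_mul_length_fareyPrefix (L n)).symm.trans_le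
      (Nat.mul_le_mul_left 2 (hlevel n).1)
  rw [norm_div, Real.norm_eq_abs, Real.norm_natCast]
  calc |deviation ((1 / 2) ^ a) d a ((List.range n).map fareyDigit)| / n
      ≤ 2 ^ (L n + 1) * (√(L n + 1 : ℕ) + (d.length + 4)) / (2 ^ L n * L n / 2) := by
        gcongr
        · exact abs_deviation_fareyDigit_le ha d (hlevel n).2.le
        · linarith
    _ = 4 * ((√(L n + 1 : ℕ) + (d.length + 4)) / L n) := by
        field_simp
        ring

lemma tendsto_occ_fareyDigit {d : List ℕ} (hd : ∀ a ∈ d, 0 < a) :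
    Tendsto (fun n : ℕ => (occ d ((List.range n).map fareyDigit) : ℝ) / n) atTop
      (𝓝 ((1 / 2) ^ d.sum)) := by
  rw [← prod_map_pow_eq_pow_sum]
  exact tendsto_occ_div_of_tendsto_deviation_div fun a ha e =>
    tendsto_deviation_fareyDigit (hd a ha) e

end MinkowskiNormality

theorem mainTheorem3 :
    -- the convergents of the concatenated continued fraction converge to `fareyNumber`,
    Tendsto MinkowskiNormality.fareyConvergent atTop (𝓝 MinkowskiNormality.fareyNumber) ∧
    -- which is an irrational number with the concatenation as its expansion,
    Irrational MinkowskiNormality.fareyNumber ∧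
    (∀ n : ℕ, MinkowskiNormality.cfDigit MinkowskiNormality.fareyNumber n =
      MinkowskiNormality.fareyDigit n) ∧
    -- and which is Minkowski normal
    MinkowskiNormality.MinkowskiNormal MinkowskiNormality.fareyNumber := by
  open MinkowskiNormality in
  exact ⟨tendsto_cfEval_cfLim fareyDigit_pos, irrational_cfLim fareyDigit_pos,
    cfDigit_cfLim fareyDigit_pos,
    minkowskiNormal_cfLim fareyDigit_pos fun _ => tendsto_occ_fareyDigit⟩
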